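/- For a commutative ring $R$, a commutative $R$-algebra $A$ and a subset $V\subseteq A$, let $\mathfrak r(V)$ be the set of all $a\in A$ for which there is an $N$ with $a^m\in V$ for all $m\ge N$. Call $V$ a Mathieu subspace of $A$ if $V$ is an $R$-submodule of $A$ and for every $a\in\mathfrak r(V)$ and every $b\in A$ there is an $N$ with $a^m b\in V$ for all $m\ge N$. Call $(B,\sigma)$ an admissible pair if $B\subseteq\mathbb R$ is open and $\sigma$ is a positive Borel measure such that every $g\in\mathbb C[t]$ is $\sigma$-integrable on $B$; put $V_B(\sigma)=\{f\in\mathbb C[t] : \int_B f\,d\sigma=0\}$. Say that $\sigma$ is atomic with finite support (on $B$) if there are finitely many (possibly no) points $r_i\in B$ with $\sigma(\{r_i\})>0$ such that for every Borel set $U\subseteq B$, $\sigma(U)$ is the sum of $\sigma(\{r_i\})$ over those $r_i$ that lie in $U$. Let $\Lambda$ be one of the operators $\mathbb C[t]\to\mathbb C(t)$ $$\partial_t-2t,\qquad \partial_t+\alpha t^{-1}-1,\qquad \partial_t-\alpha(1-t)^{-1}+\beta(1+t)^{-1}\qquad(\alpha,\beta\in\mathbb R,\ \alpha,\beta>-1),$$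 attached to the Hermite, generalized Laguerre and Jacobi polynomials respectively, and put $\mathrm{Im}'\Lambda=\mathbb C[t]\cap\Lambda(\mathbb C[t])$. Consider the following four assertions. - Integral Conjecture (in dimension one): for every admissible pair $(B,\sigma)$, $V_B(\sigma)$ is a Mathieu subspace of the $\mathbb C$-algebra $\mathbb C[t]$. - Strong Integral Conjecture: for every admissible pair $(B,\sigma)$ such that $\sigma$ is not atomic with finite support, $\mathfrak r(V_B(\sigma))=\{0\}$. - Image Conjecture for classical orthogonal polynomials: for every $\Lambda$ as above, $\mathrm{Im}'\Lambda$ is a Mathieu subspace of the $\mathbb C$-algebra $\mathbb C[t]$. - Strong Image Conjecture for classical orthogonal polynomials: for every $\Lambda$ as above with $1\notin\mathrm{Im}'\Lambda$, $\mathfrak r(\mathrm{Im}'\Lambda)=\{0\}$. **Theorem 5.3.** (i) The Integral Conjecture is equivalent to the Strong Integral Conjecture. Moreover, the equivalence holds for each admissible pair $(B,\sigma)$ separately: $V_B(\sigma)$ is a Mathieu subspace of $\mathbb C[t]$ if and only if either $\sigma$ is atomic with finite support or $\mathfrak r(V_B(\sigma))=\{0\}$. (ii) The Image Conjecture for classical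 orthogonal polynomials is equivalent to the Strong Image Conjecture for classical orthogonal polynomials. Moreover, the equivalence holds for each operator $\Lambda$ separately: $\mathrm{Im}'\Lambda$ is a Mathieu subspace of $\mathbb C[t]$ if and only if either $1\in\mathrm{Im}'\Lambda$ or $\mathfrak r(\mathrm{Im}'\Lambda)=\{0\}$. -/

import Mathlib

open MeasureTheory Polynomial

noncomputable section

namespace MathieuUnivariate

/-- The radical of a subset `V` of a commutative algebra: all `a` with `a ^ m ∈ V` for all
large `m`. -/
def radical {A : Type*} [CommRing A] (V : Set A) : Set A :=
  {a | ∃ N : ℕ, ∀ m : ℕ, N ≤ m → a ^ m ∈ V}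

/-- A subset `V` of a commutative `R`-algebra `A` is a Mathieu subspace if it is an
`R`-submodule and, for every `a` in its radical and every `b : A`, one has `a ^ m * b ∈ V`
for all large `m`. -/
def IsMathieuSubspace (R : Type*) {A : Type*} [CommRing R] [CommRing A] [Algebra R A]
    (V : Set A) : Prop :=
  (∃ W : Submodule R A, (W : Set A) = V) ∧
    ∀ a ∈ radical V, ∀ b : A, ∃ N : ℕ, ∀ m : ℕ, N ≤ m → a ^ m * b ∈ V

/-- `B` is an open subset of the real line and every complex polynomial has a (finite)
integral over `B` with respect to the positive Borel measure `σ`. -/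
def IsAdmissible (B : Set ℝ) (σ : Measure ℝ) : Prop :=
  IsOpen B ∧ ∀ g : ℂ[X], IntegrableOn (fun t : ℝ => g.eval (t : ℂ)) B σ

/-- `V_B(σ)`: the complex polynomials whose integral over `B` with respect to `σ` vanishes. -/
def integralKernel (B : Set ℝ) (σ : Measure ℝ) : Set ℂ[X] :=
  {f | ∫ t in B, f.eval (t : ℂ) ∂σ = 0}

/-- On `B`, the measure `σ` is atomic and supported at finitely many points `r` of `B`: each of
them has positive mass and every (measurable) `U ⊆ B` has as mass the sum of the masses of the
points it contains. The set of points may be empty: the zero measure is included. -/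
def IsFinitelyAtomic (B : Set ℝ) (σ : Measure ℝ) : Prop :=
  ∃ S : Finset ℝ, (S : Set ℝ) ⊆ B ∧ (∀ r ∈ S, 0 < σ {r}) ∧
    ∀ U : Set ℝ, U ⊆ B → MeasurableSet U →
      σ U = ∑ r ∈ S, U.indicator (fun x => σ {x}) r

/-- The one-dimensional Integral Conjecture. -/
def IntegralConjecture : Prop :=
  ∀ (B : Set ℝ) (σ : Measure ℝ), IsAdmissible B σ → IsMathieuSubspace ℂ (integralKernel B σ)

/-- The one-dimensional Strong Integral Conjecture. -/
def StrongIntegralConjecture : Prop :=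
  ∀ (B : Set ℝ) (σ : Measure ℝ), IsAdmissible B σ → ¬ IsFinitelyAtomic B σ →
    radical (integralKernel B σ) = {0}

/-- The families of classical univariate orthogonal polynomials, with their parameters:
Hermite (`w = exp (-t ^ 2)` on `ℝ`), generalized Laguerre (`w = t ^ α * exp (-t)` on `(0, ∞)`)
and Jacobi (`w = (1 - t) ^ α * (1 + t) ^ β` on `(-1, 1)`). -/
inductive ClassicalFamily : Type
  | hermite : ClassicalFamily
  | laguerre (α : ℝ) (hα : -1 < α) : ClassicalFamily
  | jacobi (α β : ℝ) (hα : -1 < α) (hβ : -1 < β) : ClassicalFamily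

/-- The logarithmic derivative `w' / w` of the weight function, a rational function. -/
def ClassicalFamily.logDerivWeight : ClassicalFamily → RatFunc ℂ
  | .hermite => -(2 * RatFunc.X)
  | .laguerre α _ => RatFunc.C (α : ℂ) * RatFunc.X⁻¹ - 1
  | .jacobi α β _ _ =>
      -(RatFunc.C (α : ℂ) * (1 - RatFunc.X)⁻¹) + RatFunc.C (β : ℂ) * (1 + RatFunc.X)⁻¹

/-- The operator `Λ = w⁻¹ ∘ ∂ₜ ∘ w = ∂ₜ + w' / w` on `ℂ[t]`, with values in `ℂ(t)`. -/
def ClassicalFamily.Lambda (F : ClassicalFamily) (f : ℂ[X]) : RatFunc ℂ :=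
  algebraMap ℂ[X] (RatFunc ℂ) (derivative f) +
    F.logDerivWeight * algebraMap ℂ[X] (RatFunc ℂ) f

/-- `Im' Λ = ℂ[t] ∩ Λ(ℂ[t])`, as a subset of `ℂ[t]`. -/
def ClassicalFamily.imPrime (F : ClassicalFamily) : Set ℂ[X] :=
  {p | ∃ f : ℂ[X], F.Lambda f = algebraMap ℂ[X] (RatFunc ℂ) p}

/-- The Image Conjecture for classical univariate orthogonal polynomials. -/
def ImageConjecture : Prop :=
  ∀ F : ClassicalFamily, IsMathieuSubspace ℂ F.imPrime

/-- The Strong Image Conjecture for classical univariate orthogonal polynomials. -/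
def StrongImageConjecture : Prop :=
  ∀ F : ClassicalFamily, (1 : ℂ[X]) ∉ F.imPrime → radical F.imPrime = {0}

end MathieuUnivariate

end

/-!
Let `V` be a Mathieu subspace of `ℂ[t]` and `a ≠ 0` an element of its radical. Since `ℂ[t]` is
free of finite rank over `ℂ[a]` (or `a` is a unit), `V` contains the ideal `(a ^ N)` for some `N`
(`IsMathieuSubspace.exists_pow_mul_mem`). In both parts the theorem comes down to the question
when `V` contains a nonzero ideal; conversely, a subspace with radical `{0}` is trivially a Mathieu
subspace.

If `V = V_B(σ)` contains `(p)`, then `∫_B |p|² dσ = 0` and `σ` is carried by the finitely many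
zeros of `p` (`IsAdmissible.isFinitelyAtomic`). If `σ` is finitely atomic, elements of the radical
vanish at all atoms, by an interpolation argument with power sums
(`eq_zero_of_sum_mul_pow_eq_zero`), and the Mathieu property follows.

For `V = Im' Λ` the argument is algebraic. From `Λ (h f) = h' f + h Λ f` one sees that, if
`(Λ f) ⊆ Im' Λ`, then `(f) ⊆ Im' Λ`; hence an ideal `(p)` in `Im' Λ` with `p ≠ 0` of least degree
has `p = Λ f` with `p ∣ f` (`ClassicalFamily.exists_mul_eq_of_ideal_subset`). Degrees and the
local exponents of `Λ` at the finite singular points (`eq_zero_of_regular_singular`) exclude this,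
except when a singular point has exponent zero, and in those cases `Im' Λ = ℂ[t]`
(`ClassicalFamily.imPrime_eq_univ_or`). A solution of `Λ f = 1` is itself an instance of
`Λ f ∣ f`, so outside these cases `1 ∉ Im' Λ`.
-/

namespace MathieuUnivariate

/-! ### Mathieu subspaces of polynomial rings -/

/-- If `V` is a Mathieu subspace of `K[X]` with a nonzero `a` in its radical, the powers `a ^ m`
multiply `1, X, ..., X ^ (deg a - 1)` into `V` for all `m ≥ N`, with one common `N`. Division with
remainder by `a` then shows that the whole ideal `(a ^ N)` lies in `V`. -/
theorem IsMathieuSubspace.exists_pow_mul_mem {K : Type*} [Field K] {V : Set K[X]}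
    (hV : IsMathieuSubspace K V) {a : K[X]} (ha : a ∈ radical V) (ha0 : a ≠ 0) :
    ∃ N : ℕ, ∀ h : K[X], a ^ N * h ∈ V := by
  obtain ⟨⟨W, rfl⟩, hM⟩ := hV
  simp only [SetLike.mem_coe] at hM ⊢
  rcases Nat.eq_zero_or_pos a.natDegree with hd | hd
  · -- A nonzero constant `a` is a unit, so already `(a ^ 0)`, the unit ideal, lies in `V`.
    refine ⟨0, fun h => ?_⟩
    obtain ⟨c, rfl⟩ := natDegree_eq_zero.1 hd
    have hc : c ≠ 0 := fun h => ha0 (by simp [h])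
    obtain ⟨N, hN⟩ := hM _ ha h
    have := W.smul_mem (c ^ N)⁻¹ (hN N le_rfl)
    rwa [← C_pow, ← smul_eq_C_mul, inv_smul_smul₀ (pow_ne_zero _ hc), ← one_mul h,
      ← pow_zero (C c)] at this
  · choose n hn using fun i : ℕ => hM a ha (X ^ i)
    have key : ∀ k : ℕ, ∀ h : K[X], h.natDegree < k →
        ∀ m, (Finset.range a.natDegree).sup n ≤ m → a ^ m * h ∈ W := by
      intro k
      induction k with
      | zero => intro h hk; omega
      | succ k ih =>
        intro h hk m hm
        rcases lt_or_ge h.natDegree a.natDegree with hlt | hge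
        · rw [h.as_sum_range' _ hlt, Finset.mul_sum]
          refine W.sum_mem fun i hi => ?_
          rw [← C_mul_X_pow_eq_monomial, mul_left_comm, ← smul_eq_C_mul]
          exact W.smul_mem _ (hn i m ((Finset.le_sup hi).trans hm))
        · rw [← EuclideanDomain.div_add_mod h a, mul_add, ← mul_assoc, ← pow_succ]
          have h1 : (h / a).natDegree < k := by
            rcases eq_or_ne (h / a) 0 with h0 | h0
            · rw [h0, natDegree_zero]; omega
            · have hh : h ≠ 0 := by rintro rfl; simp at h0
              have := natDegree_lt_natDegree h0
                (degree_div_lt hh (natDegree_pos_iff_degree_pos.1 hd))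
              omega
          have h2 : (h % a).natDegree < k :=
            (natDegree_mod_lt h hd.ne').trans_le (by omega)
          exact W.add_mem (ih _ h1 _ (by omega)) (ih _ h2 _ hm)
    exact ⟨_, fun h => key _ h (Nat.lt_succ_self _) _ le_rfl⟩

theorem isMathieuSubspace_of_radical_eq {K A : Type*} [CommRing K] [CommRing A] [Algebra K A]
    (W : Submodule K A) (h : radical (W : Set A) = {0}) : IsMathieuSubspace K (W : Set A) := by
  refine ⟨⟨W, rfl⟩, fun a ha b => ⟨1, fun m hm => ?_⟩⟩
  rw [h, Set.mem_singleton_iff] at ha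
  simp [ha, zero_pow (show m ≠ 0 by omega)]

theorem radical_eq_singleton {K A : Type*} [CommRing K] [CommRing A] [Algebra K A]
    (W : Submodule K A) (h : ∀ a ∈ radical (W : Set A), a = 0) : radical (W : Set A) = {0} := by
  refine Set.Subset.antisymm h ?_
  rintro _ rfl
  exact ⟨1, fun m hm => by simp [zero_pow (show m ≠ 0 by omega)]⟩

/-! ### Kernels of integrals -/

/-- Points at which all high power sums with positive weights vanish are all zero: by linearity
the weighted sum of `x ^ N * P x` vanishes for every polynomial `P`, and interpolating
`conj x ^ N` turns it into the sum of the nonnegative terms `c * |x| ^ (2 * N)`. -/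
theorem eq_zero_of_sum_mul_pow_eq_zero {ι : Type*} (S : Finset ι) (c : ι → ℝ)
    (hc : ∀ r ∈ S, 0 < c r) (x : ι → ℂ) (N : ℕ)
    (h : ∀ m, N ≤ m → ∑ r ∈ S, (c r : ℂ) * x r ^ m = 0) : ∀ r ∈ S, x r = 0 := by
  classical
  have hP : ∀ P : ℂ[X], ∑ r ∈ S, (c r : ℂ) * (x r ^ N * P.eval (x r)) = 0 := by
    intro P
    induction P using Polynomial.induction_on' with
    | add p q hp hq =>
      simp only [eval_add, mul_add, Finset.sum_add_distrib, hp, hq, add_zero]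
    | monomial n b =>
      have := congrArg (b * ·) (h (N + n) (by omega))
      simp only [Finset.mul_sum, mul_zero] at this
      rw [← this]
      refine Finset.sum_congr rfl fun r _ => ?_
      rw [eval_monomial]; ring
  have h1 := hP (Lagrange.interpolate (S.image x) id fun z => (starRingEnd ℂ z) ^ N)
  have h2 : ∑ r ∈ S, c r * Complex.normSq (x r) ^ N = 0 := by
    rw [← Complex.ofReal_inj, Complex.ofReal_zero, ← h1, Complex.ofReal_sum]
    refine Finset.sum_congr rfl fun r hr => ?_
    have := Lagrange.eval_interpolate_at_node (fun z : ℂ => (starRingEnd ℂ z) ^ N)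
      (s := S.image x) (v := id) Function.injective_id.injOn (Finset.mem_image_of_mem x hr)
    rw [id] at this
    rw [this, ← mul_pow, Complex.mul_conj]
    push_cast; rfl
  intro r hr
  have h3 := (Finset.sum_eq_zero_iff_of_nonneg fun r hr =>
    mul_nonneg (hc r hr).le (pow_nonneg (Complex.normSq_nonneg _) _)).1 h2 r hr
  exact Complex.normSq_eq_zero.1 (eq_zero_of_pow_eq_zero
    ((mul_eq_zero.1 h3).resolve_left (hc r hr).ne'))

/-- `V_B(σ)` as a `ℂ`-subspace of `ℂ[t]`; closure under addition uses that all polynomials are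
integrable. -/
def IsAdmissible.integralKernelSubmodule {B : Set ℝ} {σ : Measure ℝ} (h : IsAdmissible B σ) :
    Submodule ℂ ℂ[X] where
  carrier := integralKernel B σ
  zero_mem' := by simp [integralKernel]
  add_mem' := by
    intro f g hf hg
    simp only [integralKernel, Set.mem_ofPred_eq, eval_add] at *
    rw [integral_add (h.2 f) (h.2 g), hf, hg, add_zero]
  smul_mem' := by
    intro c f hf
    simp only [integralKernel, Set.mem_ofPred_eq, eval_smul, smul_eq_mul] at *
    rw [integral_const_mul, hf, mul_zero]

theorem IsAdmissible.measure_lt_top {B : Set ℝ} {σ : Measure ℝ} (h : IsAdmissible B σ) :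
    σ B < ⊤ := by
  have := h.2 1
  simpa [integrableOn_const_iff] using this

/-- For a finitely atomic `σ`, `∫_B f dσ` is a positive combination of the values of `f` at the
atoms, so every element of the radical vanishes at all atoms. -/
theorem IsFinitelyAtomic.isMathieuSubspace {B : Set ℝ} {σ : Measure ℝ} (h : IsAdmissible B σ)
    (ha : IsFinitelyAtomic B σ) : IsMathieuSubspace ℂ (integralKernel B σ) := by
  obtain ⟨S, hSB, hS, hU⟩ := ha
  have hfin : ∀ r ∈ S, σ {r} ≠ ⊤ := fun r hr =>
    ((measure_mono (Set.singleton_subset_iff.2 (hSB hr))).trans_lt h.measure_lt_top).ne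
  have hres : σ.restrict B = ∑ r ∈ S, σ {r} • Measure.dirac r := by
    ext U hUm
    rw [Measure.restrict_apply hUm, hU _ Set.inter_subset_right (hUm.inter h.1.measurableSet),
      Measure.finsetSum_apply]
    refine Finset.sum_congr rfl fun r hr => ?_
    rw [Measure.smul_apply, Measure.dirac_apply' _ hUm]
    by_cases hrU : r ∈ U <;> simp [hrU, hSB hr]
  have hint : ∀ f : ℂ[X], ∫ t in B, f.eval (t : ℂ) ∂σ =
      ∑ r ∈ S, ((σ {r}).toReal : ℂ) * f.eval (r : ℂ) := by
    intro f
    rw [hres, integral_finsetSum_measure]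
    · simp
    · intro r hr
      exact (integrable_dirac (by simp)).smul_measure (hfin r hr)
  refine ⟨⟨h.integralKernelSubmodule, rfl⟩, fun a ⟨N, hN⟩ b => ⟨1, fun m hm => ?_⟩⟩
  have hz : ∀ r ∈ S, a.eval (r : ℂ) = 0 :=
    eq_zero_of_sum_mul_pow_eq_zero S (fun r => (σ {r}).toReal)
      (fun r hr => ENNReal.toReal_pos (hS r hr).ne' (hfin r hr)) _ N fun m hm => by
        have := hN m hm
        simpa only [integralKernel, Set.mem_ofPred_eq, hint, eval_pow] using this
  simp only [integralKernel, Set.mem_ofPred_eq]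
  rw [hint]
  refine Finset.sum_eq_zero fun r hr => ?_
  simp [hz r hr, zero_pow (show m ≠ 0 by omega)]

/-- The points of `Z` need not lie in `B` or carry mass; those that do are the atoms. -/
theorem isFinitelyAtomic_of_measure_diff_eq_zero {B : Set ℝ} {σ : Measure ℝ} (Z : Finset ℝ)
    (hZ : σ (B \ Z) = 0) : IsFinitelyAtomic B σ := by
  classical
  refine ⟨Z.filter fun r => r ∈ B ∧ 0 < σ {r}, ?_, ?_, ?_⟩
  · intro r hr
    simp only [Finset.coe_filter, Set.mem_ofPred_eq] at hr
    exact hr.2.1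
  · intro r hr
    exact (Finset.mem_filter.1 hr).2.2
  · intro U hUB hUm
    have h1 : σ U = σ ((Z.filter (· ∈ U) : Finset ℝ) : Set ℝ) := by
      rw [← measure_inter_add_sdiff U Z.measurableSet,
        measure_mono_null (Set.sdiff_subset_sdiff_left hUB) hZ, add_zero]
      congr 1
      ext r
      simp [and_comm]
    rw [h1, ← sum_measure_singleton, Finset.sum_filter, Finset.sum_filter]
    refine Finset.sum_congr rfl fun r _ => ?_
    by_cases hr : r ∈ U
    · simp [hr, hUB hr, eq_comm]
    · simp [hr]

/-- If `∫_B p g dσ = 0` for all `g`, then taking for `g` the conjugate of `p` gives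
`∫_B |p|² dσ = 0`, so `σ` lives on the finitely many real zeros of `p`. -/
theorem IsAdmissible.isFinitelyAtomic {B : Set ℝ} {σ : Measure ℝ} (h : IsAdmissible B σ)
    {p : ℂ[X]} (hp : p ≠ 0) (hker : ∀ g : ℂ[X], p * g ∈ integralKernel B σ) :
    IsFinitelyAtomic B σ := by
  have h1 := hker (p.map (starRingEnd ℂ))
  have heval : ∀ t : ℝ, (p * p.map (starRingEnd ℂ)).eval (t : ℂ) =
      (Complex.normSq (p.eval (t : ℂ)) : ℂ) := by
    intro t
    have : (p.map (starRingEnd ℂ)).eval (t : ℂ) = starRingEnd ℂ (p.eval (t : ℂ)) := by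
      conv_lhs => rw [← Complex.conj_ofReal t]
      rw [eval_map, eval₂_hom]
    rw [eval_mul, this, Complex.mul_conj]
  have hi := h.2 (p * p.map (starRingEnd ℂ))
  simp only [integralKernel, Set.mem_ofPred_eq, heval] at h1 hi
  rw [integral_complex_ofReal, Complex.ofReal_eq_zero,
    integral_eq_zero_iff_of_nonneg (fun t => Complex.normSq_nonneg _)
      (by simpa using Integrable.re hi)] at h1
  refine isFinitelyAtomic_of_measure_diff_eq_zero
    (p.roots.toFinset.preimage ((↑) : ℝ → ℂ) Complex.ofReal_injective.injOn) ?_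
  have h2 := (ae_restrict_iff' h.1.measurableSet).1 h1
  refine measure_mono_null ?_ h2
  rintro t ⟨htB, htZ⟩
  simp [hp] at htZ
  simp [htB, htZ]

theorem isMathieuSubspace_integralKernel_iff {B : Set ℝ} {σ : Measure ℝ} (h : IsAdmissible B σ) :
    IsMathieuSubspace ℂ (integralKernel B σ) ↔
      (¬ IsFinitelyAtomic B σ → radical (integralKernel B σ) = {0}) := by
  constructor
  · intro hM hna
    refine radical_eq_singleton h.integralKernelSubmodule fun a ha => ?_
    by_contra ha0
    obtain ⟨N, hN⟩ := hM.exists_pow_mul_mem ha ha0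
    exact hna (h.isFinitelyAtomic (pow_ne_zero N ha0) hN)
  · intro hr
    by_cases ha : IsFinitelyAtomic B σ
    · exact ha.isMathieuSubspace h
    · exact isMathieuSubspace_of_radical_eq h.integralKernelSubmodule (hr ha)

/-! ### Ideals in the image of a first-order operator -/

/-- `Im' Λ` as a `ℂ`-subspace of `ℂ[t]`. -/
def ClassicalFamily.imPrimeSubmodule (F : ClassicalFamily) : Submodule ℂ ℂ[X] where
  carrier := F.imPrime
  zero_mem' := ⟨0, by simp [Lambda]⟩
  add_mem' := by
    rintro p q ⟨f, hf⟩ ⟨g, hg⟩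
    refine ⟨f + g, ?_⟩
    rw [map_add, ← hf, ← hg]
    simp only [Lambda, map_add]
    ring
  smul_mem' := by
    rintro c p ⟨f, hf⟩
    refine ⟨C c * f, ?_⟩
    rw [smul_eq_C_mul, map_mul, ← hf]
    simp only [Lambda, derivative_C_mul, map_mul]
    ring

theorem ClassicalFamily.Lambda_mul (F : ClassicalFamily) (h f : ℂ[X]) :
    F.Lambda (h * f) = algebraMap ℂ[X] (RatFunc ℂ) (derivative h * f) +
      algebraMap ℂ[X] (RatFunc ℂ) h * F.Lambda f := by
  simp only [Lambda, derivative_mul, map_add, map_mul]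
  ring

theorem exists_derivative_eq (h : ℂ[X]) : ∃ g : ℂ[X], derivative g = h := by
  induction h using Polynomial.induction_on' with
  | add p q hp hq =>
    obtain ⟨a, rfl⟩ := hp
    obtain ⟨b, rfl⟩ := hq
    exact ⟨a + b, derivative_add⟩
  | monomial n c =>
    refine ⟨monomial (n + 1) (c / (n + 1)), ?_⟩
    rw [derivative_monomial]
    have : (n + 1 : ℂ) ≠ 0 := by exact_mod_cast n.succ_ne_zero
    simp [div_mul_cancel₀ _ this]

/-- If the ideal `(p)` lies in `Im' Λ` and `Λ f = p`, then so does `(f)`: in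
`Λ (g f) = g' f + g p` both the left side and `g p` lie in `Im' Λ`, and every polynomial is some
`g'`. -/
theorem ClassicalFamily.mul_preimage_mem (F : ClassicalFamily) {p f : ℂ[X]}
    (hp : ∀ h : ℂ[X], p * h ∈ F.imPrime)
    (hf : F.Lambda f = algebraMap ℂ[X] (RatFunc ℂ) p) (h : ℂ[X]) : f * h ∈ F.imPrime := by
  obtain ⟨g, rfl⟩ := exists_derivative_eq h
  have h1 : derivative g * f + g * p ∈ F.imPrime :=
    ⟨g * f, by rw [F.Lambda_mul, hf, map_add, map_mul _ g p]⟩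
  have := F.imPrimeSubmodule.sub_mem h1 (hp g)
  change _ ∈ F.imPrimeSubmodule
  convert this using 1
  ring

/-- If `Im' Λ` contains a nonzero ideal, let `(p)` be one with generator of least degree. A
preimage `f` of `p` generates an ideal in `Im' Λ` too, and so does its remainder modulo `p`;
minimality forces `p ∣ f`. -/
theorem ClassicalFamily.exists_mul_eq_of_ideal_subset (F : ClassicalFamily) {a : ℂ[X]}
    (ha0 : a ≠ 0) (ha : ∀ h : ℂ[X], a * h ∈ F.imPrime) :
    ∃ p q : ℂ[X], q * p ≠ 0 ∧ F.Lambda (q * p) = algebraMap ℂ[X] (RatFunc ℂ) p := by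
  obtain ⟨p, ⟨hp0, hp⟩, hmin⟩ := exists_minimalFor_of_wellFoundedLT
    (fun p : ℂ[X] => p ≠ 0 ∧ ∀ h : ℂ[X], p * h ∈ F.imPrime) (fun p => p.degree) ⟨a, ha0, ha⟩
  obtain ⟨f, hf⟩ := hp 1
  rw [mul_one] at hf
  have hmod : f % p = 0 := by
    by_contra hne
    refine (degree_mod_lt f hp0).not_ge (hmin ⟨hne, fun h => ?_⟩ (degree_mod_lt f hp0).le)
    have := F.imPrimeSubmodule.sub_mem (F.mul_preimage_mem hp hf h) (hp (f / p * h))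
    change _ ∈ F.imPrimeSubmodule
    convert this using 1
    rw [EuclideanDomain.mod_eq_sub_mul_div]
    ring
  obtain ⟨q, rfl⟩ := (EuclideanDomain.mod_eq_zero).1 hmod
  rw [mul_comm p q] at hf
  refine ⟨p, q, fun h => hp0 ?_, hf⟩
  rw [h] at hf
  exact RatFunc.algebraMap_injective ℂ (by rw [← hf]; simp [Lambda])

/-! ### Auxiliary differential equations -/

/-- Uniqueness at a regular singular point `r`: let `f = q p` with `q r ≠ 0` solve
`f' + (α / (t - r) + B / A) f = p`, with denominators cleared. If `f` is divisible by
`(t - r) ^ k`, then so is `p`, and comparing coefficients at order `k` gives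
`(k + α) A(r) (f / (t - r) ^ k)(r) = 0`. As `-α` is not a natural number, `f` vanishes at `r` to
every order. -/
theorem eq_zero_of_regular_singular {K : Type*} [Field K] {r α : K} (hα : ∀ n : ℕ, (n : K) + α ≠ 0)
    {A B p q f : K[X]} (hA : A.eval r ≠ 0) (hq : q.eval r ≠ 0) (hf : f = q * p)
    (h : (X - C r) * A * derivative f + (C α * A + (X - C r) * B) * f = (X - C r) * A * p) :
    f = 0 := by
  by_contra hf0
  have key : ∀ k : ℕ, (X - C r) ^ k ∣ f := by
    intro k
    induction k with
    | zero => simp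
    | succ k ih =>
      have hcop : IsCoprime ((X - C r) ^ k) q :=
        (((irreducible_X_sub_C r).coprime_iff_not_dvd).2
          fun hd => hq (dvd_iff_isRoot.1 hd)).pow_left
      have hp : (X - C r) ^ k ∣ p := hcop.dvd_of_dvd_mul_left (hf ▸ ih)
      obtain ⟨v, hv⟩ := hp
      obtain ⟨u, hu⟩ := ih
      have hX : (X - C r) ^ k ≠ 0 := pow_ne_zero _ (X_sub_C_ne_zero r)
      have hd : (X - C r) * derivative f =
          (X - C r) ^ k * (C (k : K) * u + (X - C r) * derivative u) := by
        rw [hu, derivative_mul, derivative_X_sub_C_pow]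
        rcases k with _ | k
        · simp
        · rw [Nat.add_sub_cancel]; push_cast; ring
      have h2 : (X - C r) ^ k * ((C (k : K) * u + (X - C r) * derivative u) * A +
          (C α * A + (X - C r) * B) * u) = (X - C r) ^ k * ((X - C r) * A * v) := by
        calc _ = (X - C r) ^ k * (C (k : K) * u + (X - C r) * derivative u) * A +
              (C α * A + (X - C r) * B) * ((X - C r) ^ k * u) := by ring
          _ = (X - C r) * A * derivative f + (C α * A + (X - C r) * B) * f := by
              rw [← hd, ← hu]; ring
          _ = _ := by rw [h, hv]; ring
      have h3 := congrArg (eval r) (mul_left_cancel₀ hX h2)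
      simp only [eval_add, eval_mul, eval_sub, eval_X, eval_C, sub_self, zero_mul, add_zero] at h3
      have h4 : u.eval r = 0 := by
        have : ((k : K) + α) * A.eval r * u.eval r = 0 := by linear_combination h3
        simpa [hα k, hA] using this
      obtain ⟨w, hw⟩ := dvd_iff_isRoot.2 h4
      exact ⟨w, by rw [hu, hw]; ring⟩
  have := natDegree_le_of_dvd (key (f.natDegree + 1)) hf0
  rw [natDegree_pow, natDegree_X_sub_C] at this
  omega

/-- The operator `(t - r) ∂ + c` is diagonal in the basis `(t - r) ^ n`, with eigenvalues
`n + c`. -/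
theorem exists_X_sub_C_mul_derivative_add (r c : ℂ) (hc : ∀ n : ℕ, (n : ℂ) + c ≠ 0) (p : ℂ[X]) :
    ∃ g : ℂ[X], (X - C r) * derivative g + C c * g = p := by
  rw [← sum_taylor_eq p r]
  refine ⟨(taylor r p).sum fun n b => C (b / (n + c)) * (X - C r) ^ n, ?_⟩
  simp only [Polynomial.sum, derivative_sum, Finset.mul_sum, ← Finset.sum_add_distrib]
  refine Finset.sum_congr rfl fun n _ => ?_
  have h1 : (X - C r) * derivative ((X - C r) ^ n) = C (n : ℂ) * (X - C r) ^ n := by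
    rw [derivative_X_sub_C_pow]
    rcases n with _ | n
    · simp
    · rw [Nat.add_sub_cancel]; push_cast; ring
  rw [derivative_C_mul, mul_left_comm, h1]
  calc _ = C ((taylor r p).coeff n / (n + c)) * (C (n : ℂ) + C c) * (X - C r) ^ n := by ring
    _ = _ := by rw [← C_add, ← C_mul, div_mul_cancel₀ _ (hc n)]

theorem exists_derivative_sub_eq (p : ℂ[X]) : ∃ f : ℂ[X], derivative f - f = p := by
  induction p using Polynomial.induction_on with
  | C a => exact ⟨-C a, by simp⟩
  | add p q hp hq =>
    obtain ⟨a, rfl⟩ := hp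
    obtain ⟨b, rfl⟩ := hq
    exact ⟨a + b, by rw [derivative_add]; ring⟩
  | monomial n a ih =>
    obtain ⟨f, hf⟩ := ih
    refine ⟨C (n + 1 : ℂ) * f - C a * X ^ (n + 1), ?_⟩
    rw [derivative_sub, derivative_C_mul, derivative_C_mul_X_pow]
    have : derivative f = C a * X ^ n + f := by rw [← hf]; ring
    rw [this, Nat.add_sub_cancel]
    push_cast
    simp only [C_mul, C_add, C_1]
    ring

/-! ### The three classical families -/

theorem Lambda_hermite_iff (f p : ℂ[X]) :
    ClassicalFamily.hermite.Lambda f = algebraMap ℂ[X] (RatFunc ℂ) p ↔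
      derivative f - 2 * X * f = p := by
  rw [← (RatFunc.algebraMap_injective ℂ).eq_iff]
  simp only [ClassicalFamily.Lambda, ClassicalFamily.logDerivWeight, map_sub, map_mul,
    RatFunc.algebraMap_X, map_ofNat]
  ring_nf

theorem Lambda_laguerre_iff {α : ℝ} (hα : -1 < α) (f p : ℂ[X]) :
    (ClassicalFamily.laguerre α hα).Lambda f = algebraMap ℂ[X] (RatFunc ℂ) p ↔
      X * derivative f + (C (α : ℂ) - X) * f = X * p := by
  rw [← (RatFunc.algebraMap_injective ℂ).eq_iff,
    ← mul_right_inj' (RatFunc.X_ne_zero (K := ℂ))]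
  have hX := RatFunc.X_ne_zero (K := ℂ)
  simp only [ClassicalFamily.Lambda, ClassicalFamily.logDerivWeight, map_sub, map_mul, map_add,
    RatFunc.algebraMap_X, RatFunc.algebraMap_C]
  refine Eq.congr_left ?_
  field_simp

theorem Lambda_jacobi_iff {α β : ℝ} (hα : -1 < α) (hβ : -1 < β) (f p : ℂ[X]) :
    (ClassicalFamily.jacobi α β hα hβ).Lambda f = algebraMap ℂ[X] (RatFunc ℂ) p ↔
      (X ^ 2 - 1) * derivative f + (C (α : ℂ) * (X + 1) + C (β : ℂ) * (X - 1)) * f =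
        (X ^ 2 - 1) * p := by
  have h1 : (1 - RatFunc.X : RatFunc ℂ) ≠ 0 := by
    rw [← RatFunc.algebraMap_X, ← map_one (algebraMap ℂ[X] (RatFunc ℂ)), ← map_sub]
    refine RatFunc.algebraMap_ne_zero fun h => ?_
    simpa using congrArg (eval 0) h
  have h2 : (1 + RatFunc.X : RatFunc ℂ) ≠ 0 := by
    rw [← RatFunc.algebraMap_X, ← map_one (algebraMap ℂ[X] (RatFunc ℂ)), ← map_add]
    refine RatFunc.algebraMap_ne_zero fun h => ?_
    simpa using congrArg (eval 0) h
  rw [← (RatFunc.algebraMap_injective ℂ).eq_iff,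
    ← mul_right_inj' (mul_ne_zero h1 h2), ← neg_inj]
  simp only [ClassicalFamily.Lambda, ClassicalFamily.logDerivWeight, map_sub, map_mul, map_add,
    map_pow, map_one, RatFunc.algebraMap_X, RatFunc.algebraMap_C]
  have e1 : -((1 - RatFunc.X) * (1 + RatFunc.X) * algebraMap ℂ[X] (RatFunc ℂ) p) =
    (RatFunc.X ^ 2 - 1) * algebraMap ℂ[X] (RatFunc ℂ) p := by ring
  rw [e1]
  refine Eq.congr_left ?_
  field_simp
  ring

/-- Here `deg Λ f = deg f + 1`, which rules out `Λ f ∣ f`. -/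
theorem hermite_eq_zero {p q : ℂ[X]}
    (h : ClassicalFamily.hermite.Lambda (q * p) = algebraMap ℂ[X] (RatFunc ℂ) p) :
    q * p = 0 := by
  rw [Lambda_hermite_iff] at h
  by_contra hne
  have hp : p.natDegree ≤ (q * p).natDegree :=
    natDegree_le_of_dvd (Dvd.intro_left q rfl) hne
  generalize q * p = f at *
  have h1 : C 2 * (X * f) = derivative f - p := by
    rw [← h, show (C 2 : ℂ[X]) = 2 from rfl]; ring
  have h2 := natDegree_sub_le_of_le ((natDegree_derivative_le f).trans (Nat.sub_le _ 1)) hp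
  rw [← h1, natDegree_C_mul two_ne_zero, natDegree_X_mul hne] at h2
  omega

theorem natCast_add_ofReal_ne_zero {α : ℝ} (hα : -1 < α) (h0 : α ≠ 0) (n : ℕ) :
    (n : ℂ) + (α : ℂ) ≠ 0 := by
  norm_cast
  rcases n with _ | n
  · simpa
  · push_cast
    have : 0 < (n : ℝ) + 1 + α := by linarith [n.cast_nonneg (α := ℝ)]
    exact this.ne'

/-- Degrees force `q` to be a nonzero constant; then the singular point `0` gives `q p = 0`. -/
theorem laguerre_eq_zero {α : ℝ} (hα : -1 < α) (h0 : α ≠ 0) {p q : ℂ[X]}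
    (h : (ClassicalFamily.laguerre α hα).Lambda (q * p) = algebraMap ℂ[X] (RatFunc ℂ) p) :
    q * p = 0 := by
  rw [Lambda_laguerre_iff] at h
  by_contra hne
  have hq : q.natDegree = 0 := by
    by_contra hq
    have hp : p.natDegree + 1 ≤ (q * p).natDegree := by
      rw [natDegree_mul (left_ne_zero_of_mul hne) (right_ne_zero_of_mul hne)]
      omega
    generalize q * p = f at *
    have h1 : X * f = X * derivative f + C (α : ℂ) * f - X * p := by
      rw [← h]; ring
    have hf : (X * derivative f).natDegree ≤ f.natDegree := by
      have := natDegree_derivative_le f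
      exact natDegree_mul_le.trans (by rw [natDegree_X]; omega)
    have h2 := natDegree_sub_le_of_le
      (natDegree_add_le_of_le hf (natDegree_C_mul_le (α : ℂ) f))
      (natDegree_mul_le.trans (by rw [natDegree_X, add_comm]; exact hp) :
        (X * p).natDegree ≤ f.natDegree)
    rw [← h1, natDegree_X_mul hne] at h2
    omega
  obtain ⟨c, rfl⟩ := natDegree_eq_zero.1 hq
  refine hne (eq_zero_of_regular_singular (r := 0) (A := 1) (B := -1)
    (natCast_add_ofReal_ne_zero hα h0) (by simp) (q := C c) ?_ rfl (p := p) ?_)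
  · rw [eval_C]
    rintro rfl
    simp at hne
  · rw [C_0]
    linear_combination h

/-- If `q` is nonzero at one of the singular points `1`, `-1`, that point gives `q p = 0`.
Otherwise `deg p ≤ deg (q p) - 2`, while a polynomial `Λ f` with `deg f ≥ 2` has degree exactly
`deg f - 1`, as `deg f + α + β ≠ 0`. -/
theorem jacobi_eq_zero {α β : ℝ} (hα : -1 < α) (hβ : -1 < β) (hα0 : α ≠ 0) (hβ0 : β ≠ 0)
    {p q : ℂ[X]}
    (h : (ClassicalFamily.jacobi α β hα hβ).Lambda (q * p) = algebraMap ℂ[X] (RatFunc ℂ) p) :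
    q * p = 0 := by
  rw [Lambda_jacobi_iff] at h
  by_cases h1 : q.eval 1 = 0
  · by_cases h2 : q.eval (-1) = 0
    · by_contra hne
      obtain ⟨s, rfl⟩ := dvd_iff_isRoot.2 h1
      have hs : s.eval (-1) = 0 := by
        have : (-1 - 1 : ℂ) ≠ 0 := by norm_num
        simpa [this] using h2
      obtain ⟨s, rfl⟩ := dvd_iff_isRoot.2 hs
      have hp : p.natDegree + 2 ≤ ((X - C 1) * ((X - C (-1)) * s) * p).natDegree := by
        have hl := left_ne_zero_of_mul hne
        rw [natDegree_mul hl (right_ne_zero_of_mul hne), natDegree_mul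
          (left_ne_zero_of_mul hl) (right_ne_zero_of_mul hl), natDegree_mul
          (left_ne_zero_of_mul (right_ne_zero_of_mul hl))
          (right_ne_zero_of_mul (right_ne_zero_of_mul hl)), natDegree_X_sub_C, natDegree_X_sub_C]
        omega
      generalize (X - C 1) * ((X - C (-1)) * s) * p = f at *
      -- Compare the coefficients of degree `deg f + 1 = m + 3` in the cleared equation.
      obtain ⟨m, hm⟩ : ∃ m, f.natDegree = m + 2 := ⟨f.natDegree - 2, by omega⟩
      have z1 : f.coeff (m + 3) = 0 := coeff_eq_zero_of_natDegree_lt (by omega)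
      have z2 : f.coeff (m + 4) = 0 := coeff_eq_zero_of_natDegree_lt (by omega)
      have z3 : p.coeff (m + 1) = 0 := coeff_eq_zero_of_natDegree_lt (by omega)
      have z4 : p.coeff (m + 3) = 0 := coeff_eq_zero_of_natDegree_lt (by omega)
      have h3 := congrArg (coeff · (m + 1 + 2)) h
      simp only [sub_mul, add_mul, mul_assoc, one_mul, coeff_add, coeff_sub, coeff_C_mul,
        coeff_X_pow_mul, coeff_X_mul, coeff_derivative, z1, z2, z3, z4] at h3
      have h4 : ((m : ℂ) + 2 + α + β) * f.coeff (m + 2) = 0 := by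
        push_cast at h3
        linear_combination h3
      have h5 : f.coeff (m + 2) ≠ 0 := by
        rw [← hm, coeff_natDegree]; exact leadingCoeff_ne_zero.2 hne
      have h6 : (m : ℝ) + 2 + α + β = 0 := by
        exact_mod_cast (mul_eq_zero.1 h4).resolve_right h5
      linarith [m.cast_nonneg (α := ℝ)]
    · refine eq_zero_of_regular_singular (r := -1) (A := X - 1) (B := C (α : ℂ))
        (natCast_add_ofReal_ne_zero hβ hβ0) (by norm_num) h2 rfl ?_
      rw [C_neg, C_1]
      linear_combination h
  · refine eq_zero_of_regular_singular (r := 1) (A := X + 1) (B := C (β : ℂ))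
      (natCast_add_ofReal_ne_zero hα hα0) (by norm_num) h1 rfl ?_
    rw [C_1]
    linear_combination h

theorem natCast_add_one_add_ofReal_ne_zero {α : ℝ} (hα : -1 < α) (n : ℕ) :
    (n : ℂ) + (1 + α : ℂ) ≠ 0 := by
  norm_cast
  have : 0 < (n : ℝ) + (1 + α) := by linarith [n.cast_nonneg (α := ℝ)]
  exact this.ne'

/-- Either `Λ` has every polynomial in its image (Laguerre with `α = 0`, Jacobi with `α = 0` or
`β = 0`), or no nonzero polynomial `f` is a multiple of a polynomial `Λ f`. -/
theorem ClassicalFamily.imPrime_eq_univ_or (F : ClassicalFamily) :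
    F.imPrime = Set.univ ∨
      ∀ p q : ℂ[X], F.Lambda (q * p) = algebraMap ℂ[X] (RatFunc ℂ) p → q * p = 0 := by
  rw [Set.eq_univ_iff_forall]
  cases F with
  | hermite => exact Or.inr fun p q => hermite_eq_zero
  | laguerre α hα =>
    rcases eq_or_ne α 0 with rfl | h0
    · refine Or.inl fun p => ?_
      obtain ⟨f, hf⟩ := exists_derivative_sub_eq p
      refine ⟨f, (Lambda_laguerre_iff _ _ _).2 ?_⟩
      rw [← hf, Complex.ofReal_zero, C_0]
      ring
    · exact Or.inr fun p q => laguerre_eq_zero hα h0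
  | jacobi α β hα hβ =>
    rcases eq_or_ne α 0 with rfl | hα0
    · refine Or.inl fun p => ?_
      obtain ⟨g, hg⟩ := exists_X_sub_C_mul_derivative_add (-1) _
        (natCast_add_one_add_ofReal_ne_zero hβ) p
      refine ⟨(X + 1) * g, (Lambda_jacobi_iff _ _ _ _).2 ?_⟩
      rw [← hg]
      simp
      ring
    · rcases eq_or_ne β 0 with rfl | hβ0
      · refine Or.inl fun p => ?_
        obtain ⟨g, hg⟩ := exists_X_sub_C_mul_derivative_add 1 _
          (natCast_add_one_add_ofReal_ne_zero hα) p
        refine ⟨(X - 1) * g, (Lambda_jacobi_iff _ _ _ _).2 ?_⟩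
        rw [← hg]
        simp
        ring
      · exact Or.inr fun p q => jacobi_eq_zero hα hβ hα0 hβ0

theorem ClassicalFamily.isMathieuSubspace_imPrime_iff (F : ClassicalFamily) :
    IsMathieuSubspace ℂ F.imPrime ↔ ((1 : ℂ[X]) ∉ F.imPrime → radical F.imPrime = {0}) := by
  constructor
  · intro hM h1
    refine radical_eq_singleton F.imPrimeSubmodule fun a ha => ?_
    by_contra ha0
    obtain ⟨N, hN⟩ := hM.exists_pow_mul_mem ha ha0
    obtain ⟨p, q, hne, hpq⟩ := F.exists_mul_eq_of_ideal_subset (pow_ne_zero N ha0) hN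
    rcases F.imPrime_eq_univ_or with huniv | hF
    · exact h1 (huniv ▸ Set.mem_univ _)
    · exact hne (hF p q hpq)
  · intro hr
    by_cases h1 : (1 : ℂ[X]) ∈ F.imPrime
    · rcases F.imPrime_eq_univ_or with huniv | hF
      · rw [huniv]
        exact ⟨⟨⊤, rfl⟩, fun _ _ _ => ⟨0, fun _ _ => Set.mem_univ _⟩⟩
      · -- `Λ f = 1` is the case `p = 1`, `q = f`, so `f = 0`; but `Λ 0 = 0`.
        obtain ⟨f, hf⟩ := h1
        have hf0 := hF 1 f (by rwa [mul_one])
        rw [mul_one] at hf0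
        subst hf0
        simp [Lambda] at hf
    · exact isMathieuSubspace_of_radical_eq F.imPrimeSubmodule (hr h1)

end MathieuUnivariate

theorem theorem5p3 :
    ((MathieuUnivariate.IntegralConjecture ↔ MathieuUnivariate.StrongIntegralConjecture) ∧
      ∀ (B : Set ℝ) (σ : Measure ℝ), MathieuUnivariate.IsAdmissible B σ →
        (MathieuUnivariate.IsMathieuSubspace ℂ (MathieuUnivariate.integralKernel B σ) ↔
          (¬ MathieuUnivariate.IsFinitelyAtomic B σ →
            MathieuUnivariate.radical (MathieuUnivariate.integralKernel B σ) = {0}))) ∧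
    ((MathieuUnivariate.ImageConjecture ↔ MathieuUnivariate.StrongImageConjecture) ∧
      ∀ F : MathieuUnivariate.ClassicalFamily,
        (MathieuUnivariate.IsMathieuSubspace ℂ F.imPrime ↔
          ((1 : ℂ[X]) ∉ F.imPrime → MathieuUnivariate.radical F.imPrime = {0}))) := by
  refine ⟨⟨?_, fun B σ h => MathieuUnivariate.isMathieuSubspace_integralKernel_iff h⟩,
    ⟨?_, fun F => F.isMathieuSubspace_imPrime_iff⟩⟩
  · exact forall₃_congr fun B σ h => MathieuUnivariate.isMathieuSubspace_integralKernel_iff h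
  · exact forall_congr' fun F => F.isMathieuSubspace_imPrime_iff
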